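/- Let $A\in\mathbb N$, let $m_1,\dots,m_A>0$ be masses, and let $M>0$ be a reference mass (for particles of equal mass $m_a=M$ all the weights $M/m_a$ below are $1$). Let $V:\mathbb R^{3A}\to\mathbb R$ be a local many-body potential: $V$ is locally integrable and $V(x_1,\dots,x_A)=\sum_{\emptyset\ne s\subseteq\{1,\dots,A\}}V_s\big((x_b)_{b\in s}\big)$, where each $V_s$ is real-valued and decays exponentially with the largest separation among its arguments (some of the $V_s$ may vanish; one-element sets $s$ give external potentials). Let $$H=-\sum_{a=1}^A\frac1{2m_a}\nabla_a^2+V ,\qquad E\in\mathbb R .$$ For a $C^1$ function $u:\mathbb R^{3A}\to\mathbb C$, $(E-H)u$ is understood in the sense of distributions. Let $\xi$ be a bounded $C^1$ function with $(E-H)\xi=0$, let $\psi$ be a $C^1$ function with $(E-H)\psi=0$ (the exact state), let $\tilde\psi$ be a $C^1$ function for which $(E-H)\tilde\psi$ is an integrable function (the approximate state), and let $\phi=\tilde\psi-\psi$. No square-integrability is required, and no particular asymptotic form of $\psi$, $\tilde\psi$ is needed; in particular they may be scattering states with the same ingoing wave. For $R>0$ and positions $y=(x_b)_{b\neq a}\in\mathbb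 R^{3(A-1)}$ of the other particles put $$S_a(R,y)=\oint_{|x_a|=R}\big(\xi^*\nabla_a\phi-(\nabla_a\xi^*)\,\phi\big)\cdot\hat n\,dS(x_a).$$ Then the following hold. 1. The total boundary term at infinity exists: the limit $$L=\lim_{R\to\infty}\ \sum_{a=1}^A\frac{M}{m_a}\int_{\{y\,:\,|x_b|<R\ \text{for all } b\ne a\}}S_a(R,y)\,dy$$ exists in $\mathbb C$, and $$|L|\le 2M\,\|\xi\|_\infty\,\|(E-H)\tilde\psi\|_1 .$$ 2. Suppose that for every $a$ the limit $\lim_{R\to\infty}S_a(R,y)$ exists for almost every $y$, and that there is an integrable function $h_a$ on $\mathbb R^{3(A-1)}$ such that for all sufficiently large $R$ one has $|S_a(R,y)|\le h_a(y)$ for almost every $y$ with $|x_b|<R$ for all $b\neq a$. Then each function $y\mapsto\lim_{R\to\infty}S_a(R,y)$ is integrable, $L$ is the sum of the iterated terms, $L=\sum_{a}\frac{M}{m_a}\int_{\mathbb R^{3(A-1)}}\lim_{R\to\infty}S_a(R,y)\,dy$, and therefore $$\Big|\sum_{a=1}^A\frac{M}{m_a}\int_{\mathbb R^{3(A-1)}}\lim_{R\to\infty}\oint_{|x_a|=R}\big(\xi^*\nabla_a\phi-(\nabla_a\xi^*)\,\phi\big)\cdot\hat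 n\,dS\,dy\Big|\le 2M\,\|\xi\|_\infty\,\|(E-H)\tilde\psi\|_1 .$$ -/

import Mathlib

open Filter Topology MeasureTheory
open scoped ContDiff ComplexConjugate

noncomputable section

namespace ManyBody

/-- Physical space `ℝ³` with its Euclidean norm. -/
abbrev Space : Type := EuclideanSpace ℝ (Fin 3)

/-- Configurations `x = (x₁, …, x_A)` of `A` particles, i.e. points of `ℝ^{3A}`
(with Lebesgue measure). -/
abbrev Config (A : ℕ) : Type := Fin A → Space

/-- Positions of all the particles except particle `a`, i.e. points of `ℝ^{3(A-1)}`. -/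
abbrev Others {A : ℕ} (a : Fin A) : Type := {b : Fin A // b ≠ a} → Space

/-- The configuration in which particle `a` sits at `p` and the others are placed as in `y`. -/
def place {A : ℕ} (a : Fin A) (p : Space) (y : Others a) : Config A :=
  fun b => if h : b = a then p else y ⟨b, h⟩

/-- The directional derivative `v · ∇ₐ f (x)` with respect to the position of particle `a`. -/
def partialDeriv {A : ℕ} (a : Fin A) (v : Space) (f : Config A → ℂ) (x : Config A) : ℂ :=
  fderiv ℝ f x (Pi.single a v)

/-- `∇ₐ f (x) · ∇ₐ h (x)`, the bilinear (not sesquilinear) product of complex gradients. -/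
def gradDot {A : ℕ} (a : Fin A) (f h : Config A → ℂ) (x : Config A) : ℂ :=
  ∑ j : Fin 3, partialDeriv a (EuclideanSpace.single j 1) f x *
    partialDeriv a (EuclideanSpace.single j 1) h x

/-- Local many-body potentials: real, locally integrable, and a sum over nonempty sets `s` of
particles of terms that depend only on the positions of the particles in `s` and decay
exponentially with the largest separation among these positions.  Terms with `s` a singleton
are external (one-body) potentials; any of the terms may vanish. -/
structure IsLocalPotential {A : ℕ} (V : Config A → ℝ) : Prop where
  locallyIntegrable : LocallyIntegrable V volume
  decomposition : ∃ U : (s : Finset (Fin A)) → (s → Space) → ℝ,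
    (∀ x : Config A, V x = ∑ s : Finset (Fin A) with s.Nonempty, U s (fun b => x b)) ∧
    ∀ s : Finset (Fin A), s.Nonempty → ∃ C ℓ r : ℝ, 0 < ℓ ∧ ∀ y : s → Space,
      r ≤ Metric.diam (Set.range y) →
        |U s y| ≤ C * Real.exp (-(Metric.diam (Set.range y)) / ℓ)

/-- `(E - H) ψ = g` in the sense of distributions, for a `C¹` wavefunction `ψ` and
`H = -∑ₐ (1 / (2 mₐ)) ∇ₐ² + V`: both sides agree when tested against every `η ∈ C_c^∞`, one
derivative of `∇ₐ² ψ` being moved to `η`. -/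
def IsSchrodingerViolation {A : ℕ} (m : Fin A → ℝ) (V : Config A → ℝ) (E : ℝ)
    (ψ g : Config A → ℂ) : Prop :=
  ContDiff ℝ 1 ψ ∧ LocallyIntegrable g volume ∧
    ∀ η : Config A → ℂ, ContDiff ℝ ∞ η → HasCompactSupport η →
      ∫ x, (((E - V x : ℝ) : ℂ) * ψ x * η x
          - ∑ a : Fin A, ((1 / (2 * m a) : ℝ) : ℂ) * gradDot a ψ η x)
        = ∫ x, g x * η x

/-- `ψ` is a `C¹` (generalized, not necessarily square-integrable) eigenfunction:
`(E - H) ψ = 0`. -/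
def IsEigenstate {A : ℕ} (m : Fin A → ℝ) (V : Config A → ℝ) (E : ℝ)
    (ψ : Config A → ℂ) : Prop :=
  IsSchrodingerViolation m V E ψ (fun _ => 0)

/-- The surface Wronskian term `∮_{|x_a| = R} n · (ξ^* ∇ₐ φ - (∇ₐ ξ^*) φ) dS`, the other particles
being held at `y`.  The sphere of radius `R` is parametrized by `n ↦ R n` on the unit sphere
with its usual surface measure (of total mass `4 π`). -/
def surfaceTerm {A : ℕ} (ξ φ : Config A → ℂ) (a : Fin A) (R : ℝ) (y : Others a) : ℂ :=
  ((R ^ 2 : ℝ) : ℂ) * ∫ n : Metric.sphere (0 : Space) 1,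
    (conj (ξ (place a (R • (n : Space)) y)) *
        partialDeriv a (n : Space) φ (place a (R • (n : Space)) y)
      - conj (partialDeriv a (n : Space) ξ (place a (R • (n : Space)) y)) *
        φ (place a (R • (n : Space)) y)) ∂((volume : Measure Space).toSphere)

end ManyBody

end

/-!
Green's identity is the choice of `ξ^* χ` and `φ χ` as test functions in the equations for `φ` and
`ξ^*`: in the difference the potential and the terms `∇φ · ∇ξ^*` cancel, and only the current
`φ ∇ₐξ^* - ξ^* ∇ₐφ` paired with `∇ₐχ` remains, balanced by `∫ ξ^* χ g` with `g = (E - H) φ`. These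
test functions are merely `C¹`, which mollification permits. For `χ = ∏_b κ(|x_b|)`, polar
coordinates in `x_a` turn the current of particle `a` into an average over radii, with weight `-κ'`,
of the surface terms `S_a(r, y)`. As `κ` sharpens to the indicator of `(-∞, R)` this becomes
`∑ₐ (M / mₐ) ∫_{|x_b| < R} S_a(R, y) dy = 2M ∫_{|x_b| < R} ξ^* g`.
Since `ξ^* g` is integrable, the right-hand side converges as `R → ∞` and obeys the bound; dominated
convergence exchanges the limit with the integral over `y`.
-/

namespace ManyBody

theorem tendsto_integral_of_dominated_on {α ι G : Type*} [MeasurableSpace α] {μ : Measure α}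
    [NormedAddCommGroup G] [NormedSpace ℝ G] {l : Filter ι} [l.IsCountablyGenerated]
    {F : ι → α → G} {F₀ : α → G} {K : Set α} {b : α → ℝ} (hK : MeasurableSet K)
    (hF : ∀ᶠ i in l, AEStronglyMeasurable (F i) μ) (hb : IntegrableOn b K μ)
    (hle : ∀ᶠ i in l, ∀ x ∈ K, ‖F i x‖ ≤ b x) (hzero : ∀ᶠ i in l, ∀ x ∉ K, F i x = 0)
    (hlim : ∀ x, Tendsto (fun i => F i x) l (𝓝 (F₀ x))) :
    Tendsto (fun i => ∫ x, F i x ∂μ) l (𝓝 (∫ x, F₀ x ∂μ)) := by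
  refine tendsto_integral_filter_of_dominated_convergence (K.indicator b) hF ?_
    ((integrable_indicator_iff hK).2 hb) (ae_of_all _ hlim)
  filter_upwards [hle, hzero] with i hle hzero
  refine ae_of_all _ fun x => ?_
  by_cases hx : x ∈ K
  · simpa only [Set.indicator_of_mem hx] using hle x hx
  · rw [Set.indicator_of_notMem hx, hzero x hx, norm_zero]

section Mollification

open scoped Convolution
open ContinuousLinearMap (lsmul)

theorem exists_contDiffBump_tendsto_rOut (G : Type*) [NormedAddCommGroup G] :
    ∃ ρ : ℕ → ContDiffBump (0 : G), (∀ n, (ρ n).rOut ≤ 1) ∧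
      Tendsto (fun n => (ρ n).rOut) atTop (𝓝 0) := by
  refine ⟨fun n => ⟨1 / (n + 1) / 2, 1 / (n + 1), by positivity, half_lt_self (by positivity)⟩,
    fun n => ?_, tendsto_one_div_add_atTop_nhds_zero_nat⟩
  exact (div_le_one (by positivity)).2 (by linarith [(n.cast_nonneg : (0 : ℝ) ≤ n)])

variable {G F : Type*} [NormedAddCommGroup G] [NormedSpace ℝ G] [FiniteDimensional ℝ G]
  [NormedAddCommGroup F] [NormedSpace ℝ F]

section Measure

variable [MeasurableSpace G] [BorelSpace G] {μ : Measure G} [μ.IsAddHaarMeasure]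

theorem norm_normed_convolution_le (ρ : ContDiffBump (0 : G)) {h : G → F} {C : ℝ}
    (hC : ∀ x, ‖h x‖ ≤ C) (x : G) : ‖(ρ.normed μ ⋆[lsmul ℝ ℝ, μ] h) x‖ ≤ C :=
  calc ‖(ρ.normed μ ⋆[lsmul ℝ ℝ, μ] h) x‖ ≤ ∫ t, ρ.normed μ t * C ∂μ := by
        refine norm_integral_le_of_norm_le (ρ.integrable_normed.mul_const C)
          (ae_of_all _ fun t => ?_)
        rw [ContinuousLinearMap.lsmul_apply, norm_smul, Real.norm_of_nonneg (ρ.nonneg_normed t)]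
        exact mul_le_mul_of_nonneg_left (hC _) (ρ.nonneg_normed t)
    _ = C := by rw [integral_mul_const, ρ.integral_normed, one_mul]

theorem tsupport_normed_convolution_subset (ρ : ContDiffBump (0 : G)) (h : G → F) :
    tsupport (ρ.normed μ ⋆[lsmul ℝ ℝ, μ] h) ⊆ Metric.cthickening ρ.rOut (tsupport h) := by
  refine closure_minimal ((support_convolution_subset _).trans ?_) Metric.isClosed_cthickening
  rw [ρ.support_normed_eq]
  rintro _ ⟨s, hs, t, ht, rfl⟩
  refine Metric.mem_cthickening_of_dist_le _ t _ _ (subset_tsupport _ ht) ?_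
  simpa using (mem_ball_zero_iff.1 hs).le

theorem fderiv_normed_convolution [CompleteSpace F] (ρ : ContDiffBump (0 : G)) {η : G → F}
    (hη : ContDiff ℝ 1 η) (hs : HasCompactSupport η) :
    fderiv ℝ (ρ.normed μ ⋆[lsmul ℝ ℝ, μ] η) = ρ.normed μ ⋆[lsmul ℝ ℝ, μ] fderiv ℝ η :=
  funext fun x =>
    (hs.hasFDerivAt_convolution_right _ ρ.continuous_normed.locallyIntegrable hη x).fderiv

end Measure

theorem exists_contDiff_tendsto_fderiv [CompleteSpace F] {η : G → F} (hη : ContDiff ℝ 1 η)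
    (hs : HasCompactSupport η) :
    ∃ (θ : ℕ → G → F) (K : Set G) (C : ℝ), IsCompact K ∧ (∀ n, ContDiff ℝ ∞ (θ n)) ∧
      (∀ n, tsupport (θ n) ⊆ K) ∧ (∀ n x, ‖θ n x‖ ≤ C) ∧ (∀ n x, ‖fderiv ℝ (θ n) x‖ ≤ C) ∧
      (∀ x, Tendsto (fun n => θ n x) atTop (𝓝 (η x))) ∧
      ∀ x, Tendsto (fun n => fderiv ℝ (θ n) x) atTop (𝓝 (fderiv ℝ η x)) := by
  borelize G
  obtain ⟨ρ, hρ_le, hρ_lim⟩ := exists_contDiffBump_tendsto_rOut G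
  have hη' : Continuous (fderiv ℝ η) := hη.continuous_fderiv one_ne_zero
  obtain ⟨C₀, hC₀⟩ := hη.continuous.bounded_above_of_compact_support hs
  obtain ⟨C₁, hC₁⟩ := hη'.bounded_above_of_compact_support (hs.fderiv ℝ)
  let μ : Measure G := Measure.addHaar
  refine ⟨fun n => (ρ n).normed μ ⋆[lsmul ℝ ℝ, μ] η, Metric.cthickening 1 (tsupport η),
    max C₀ C₁, hs.isCompact.cthickening, fun n => ?_, fun n => ?_,
    fun n => norm_normed_convolution_le _ fun x => (hC₀ x).trans (le_max_left _ _), fun n => ?_,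
    ContDiffBump.convolution_tendsto_right_of_continuous hρ_lim hη.continuous, fun x => ?_⟩
  · exact (ρ n).hasCompactSupport_normed.contDiff_convolution_left _ (ρ n).contDiff_normed
      hη.continuous.locallyIntegrable
  · exact (tsupport_normed_convolution_subset _ _).trans (Metric.cthickening_mono (hρ_le n) _)
  · rw [fderiv_normed_convolution _ hη hs]
    exact norm_normed_convolution_le _ fun x => (hC₁ x).trans (le_max_right _ _)
  · simp only [fderiv_normed_convolution _ hη hs]
    exact ContDiffBump.convolution_tendsto_right_of_continuous hρ_lim hη' x

end Mollification

variable {A : ℕ} {m : Fin A → ℝ} {V : Config A → ℝ} {E : ℝ}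

section PartialDerivatives

variable {f h : Config A → ℂ}

theorem continuous_partialDeriv (hf : ContDiff ℝ 1 f) (a : Fin A) :
    Continuous fun q : Space × Config A => partialDeriv a q.1 f q.2 :=
  ((hf.continuous_fderiv one_ne_zero).comp continuous_snd).clm_apply
    ((ContinuousLinearMap.single ℝ (fun _ : Fin A => Space) a).continuous.comp continuous_fst)

theorem partialDeriv_mul (hf : ContDiff ℝ 1 f) (hh : ContDiff ℝ 1 h) (a : Fin A) (v : Space)
    (x : Config A) :
    partialDeriv a v (fun x => f x * h x) x
      = f x * partialDeriv a v h x + h x * partialDeriv a v f x := by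
  simp only [partialDeriv, fderiv_fun_mul (hf.differentiable one_ne_zero x)
    (hh.differentiable one_ne_zero x), add_apply, smul_apply, smul_eq_mul]

theorem partialDeriv_sub (hf : ContDiff ℝ 1 f) (hh : ContDiff ℝ 1 h) (a : Fin A) (v : Space)
    (x : Config A) :
    partialDeriv a v (fun x => f x - h x) x = partialDeriv a v f x - partialDeriv a v h x := by
  simp only [partialDeriv, fderiv_fun_sub (hf.differentiable one_ne_zero x)
    (hh.differentiable one_ne_zero x), sub_apply]

theorem partialDeriv_conj (hf : ContDiff ℝ 1 f) (a : Fin A) (v : Space) (x : Config A) :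
    partialDeriv a v (fun x => conj (f x)) x = conj (partialDeriv a v f x) :=
  congrArg (fun L => L (Pi.single a v)) (Complex.conjCLE.toContinuousLinearMap.hasFDerivAt.comp x
    (hf.differentiable one_ne_zero x).hasFDerivAt).fderiv

theorem sum_partialDeriv_mul_coord (f : Config A → ℂ) (a : Fin A) (v : Space) (x : Config A) :
    ∑ j : Fin 3, partialDeriv a (EuclideanSpace.single j 1) f x * (v j : ℂ)
      = partialDeriv a v f x := by
  let D : Space →L[ℝ] ℂ :=
    (fderiv ℝ f x).comp (ContinuousLinearMap.single ℝ (fun _ : Fin A => Space) a)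
  have hv : ∑ j : Fin 3, v j • EuclideanSpace.single j (1 : ℝ) = v := by
    simpa using (EuclideanSpace.basisFun (Fin 3) ℝ).sum_repr v
  calc ∑ j : Fin 3, D (EuclideanSpace.single j 1) * (v j : ℂ)
      = D (∑ j : Fin 3, v j • EuclideanSpace.single j (1 : ℝ)) := by
        simp only [map_sum, map_smul, Complex.real_smul, mul_comm]
    _ = D v := by rw [hv]

theorem norm_partialDeriv_le (f : Config A → ℂ) (a : Fin A) (v : Space) (x : Config A) :
    ‖partialDeriv a v f x‖ ≤ ‖fderiv ℝ f x‖ * ‖v‖ := by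
  simpa only [partialDeriv, Pi.norm_single] using (fderiv ℝ f x).le_opNorm (Pi.single a v)

theorem gradDot_comm (a : Fin A) (f h : Config A → ℂ) (x : Config A) :
    gradDot a f h x = gradDot a h f x := by
  simp only [gradDot, mul_comm]

theorem gradDot_mul_right (hf : ContDiff ℝ 1 f) (hh : ContDiff ℝ 1 h) (a : Fin A)
    (u : Config A → ℂ) (x : Config A) :
    gradDot a u (fun x => f x * h x) x = f x * gradDot a u h x + h x * gradDot a u f x := by
  simp only [gradDot, partialDeriv_mul hf hh, Finset.mul_sum, ← Finset.sum_add_distrib]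
  exact Finset.sum_congr rfl fun j _ => by ring

theorem continuous_gradDot (hf : ContDiff ℝ 1 f) (hh : ContDiff ℝ 1 h) (a : Fin A) :
    Continuous (gradDot a f h) :=
  continuous_finsetSum _ fun _ _ =>
    ((continuous_partialDeriv hf a).comp (by fun_prop : Continuous fun x => (_, x))).mul
      ((continuous_partialDeriv hh a).comp (by fun_prop : Continuous fun x => (_, x)))

theorem gradDot_eq_zero_of_notMem_tsupport (a : Fin A) (f : Config A → ℂ) {x : Config A}
    (hx : x ∉ tsupport h) : gradDot a f h x = 0 := by
  have hx' : fderiv ℝ h x = 0 :=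
    image_eq_zero_of_notMem_tsupport fun hx' => hx (tsupport_fderiv_subset ℝ hx')
  simp only [gradDot, partialDeriv, hx', zero_apply, mul_zero, Finset.sum_const_zero]

theorem hasCompactSupport_gradDot (hh : HasCompactSupport h) (a : Fin A) (f : Config A → ℂ) :
    HasCompactSupport (gradDot a f h) :=
  HasCompactSupport.intro hh fun _ hx => gradDot_eq_zero_of_notMem_tsupport a f hx

theorem norm_gradDot_le (a : Fin A) (f h : Config A → ℂ) (x : Config A) :
    ‖gradDot a f h x‖ ≤ 3 * ‖fderiv ℝ f x‖ * ‖fderiv ℝ h x‖ :=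
  calc ‖gradDot a f h x‖ ≤ ∑ _j : Fin 3, ‖fderiv ℝ f x‖ * ‖fderiv ℝ h x‖ := by
        refine norm_sum_le_of_le _ fun j _ => (norm_mul_le _ _).trans ?_
        gcongr <;> simpa using norm_partialDeriv_le _ a (EuclideanSpace.single j 1) x
    _ = 3 * ‖fderiv ℝ f x‖ * ‖fderiv ℝ h x‖ := by
        rw [Finset.sum_const, Finset.card_univ, Fintype.card_fin, nsmul_eq_mul, Nat.cast_ofNat,
          mul_assoc]

end PartialDerivatives

section WeakForm

variable {f g φ gf gφ η : Config A → ℂ}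

/-- The integrand of the weak form of `(E - H) f`: the distribution `(E - H) f` acts on a test
function `η` by integrating `schrodingerForm m V E f η`. It is bilinear in `f` and `η`. -/
noncomputable def schrodingerForm (m : Fin A → ℝ) (V : Config A → ℝ) (E : ℝ) (f η : Config A → ℂ)
    (x : Config A) : ℂ :=
  ((E - V x : ℝ) : ℂ) * f x * η x - ∑ a : Fin A, ((1 / (2 * m a) : ℝ) : ℂ) * gradDot a f η x

theorem schrodingerForm_eq_zero_of_notMem_tsupport (f : Config A → ℂ) {x : Config A}
    (hx : x ∉ tsupport η) : schrodingerForm m V E f η x = 0 := by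
  simp only [schrodingerForm, image_eq_zero_of_notMem_tsupport hx,
    gradDot_eq_zero_of_notMem_tsupport _ _ hx, mul_zero, Finset.sum_const_zero, sub_zero]

theorem norm_schrodingerForm_le (f : Config A → ℂ) {x : Config A} {C : ℝ} (h₀ : ‖η x‖ ≤ C)
    (h₁ : ‖fderiv ℝ η x‖ ≤ C) :
    ‖schrodingerForm m V E f η x‖ ≤ (‖((E - V x : ℝ) : ℂ) * f x‖
      + ∑ a, ‖((1 / (2 * m a) : ℝ) : ℂ)‖ * (3 * ‖fderiv ℝ f x‖)) * C := by
  rw [add_mul, Finset.sum_mul]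
  refine (norm_sub_le _ _).trans (add_le_add ?_ (norm_sum_le_of_le _ fun a _ => ?_))
  · rw [norm_mul _ (η x)]
    gcongr
  · rw [norm_mul, mul_assoc]
    gcongr
    exact (norm_gradDot_le a f η x).trans (by gcongr)

theorem locallyIntegrable_potential_mul (hV : LocallyIntegrable V volume) (hf : Continuous f) :
    LocallyIntegrable (fun x => ((E - V x : ℝ) : ℂ) * f x) volume := by
  have hEV : LocallyIntegrable (fun x => E - V x) volume :=
    continuous_const.locallyIntegrable.sub hV
  have hEV' : LocallyIntegrable (fun x => ((E - V x : ℝ) : ℂ)) volume :=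
    hEV.mono (Complex.continuous_ofReal.comp_aestronglyMeasurable hEV.aestronglyMeasurable)
      (ae_of_all _ fun x => by rw [Complex.norm_real])
  exact hEV'.smul_continuous hf

theorem integrable_schrodingerForm (hV : LocallyIntegrable V volume) (hf : ContDiff ℝ 1 f)
    (hη : ContDiff ℝ 1 η) (hs : HasCompactSupport η) :
    Integrable (schrodingerForm m V E f η) volume :=
  ((locallyIntegrable_potential_mul hV hf.continuous).integrable_smul_right_of_hasCompactSupport
      hη.continuous hs).sub <|
    integrable_finsetSum _ fun a _ => ((continuous_gradDot hf hη a).integrable_of_hasCompactSupport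
      (hasCompactSupport_gradDot hs a f)).const_mul _

theorem tendsto_schrodingerForm {θ : ℕ → Config A → ℂ} {x : Config A} (f : Config A → ℂ)
    (hθ : Tendsto (fun n => θ n x) atTop (𝓝 (η x)))
    (hθ' : Tendsto (fun n => fderiv ℝ (θ n) x) atTop (𝓝 (fderiv ℝ η x))) :
    Tendsto (fun n => schrodingerForm m V E f (θ n) x) atTop
      (𝓝 (schrodingerForm m V E f η x)) := by
  have hgrad : ∀ a, Tendsto (fun n => gradDot a f (θ n) x) atTop (𝓝 (gradDot a f η x)) :=
    fun a => tendsto_finsetSum _ fun j _ =>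
      (((ContinuousLinearMap.apply ℝ ℂ _).continuous.tendsto _).comp hθ').const_mul _
  exact (hθ.const_mul _).sub (tendsto_finsetSum _ fun a _ => (hgrad a).const_mul _)

theorem tendsto_integral_schrodingerForm (hV : LocallyIntegrable V volume) (hf : ContDiff ℝ 1 f)
    {θ : ℕ → Config A → ℂ} {K : Set (Config A)} {C : ℝ} (hK : IsCompact K)
    (hθ : ∀ n, ContDiff ℝ 1 (θ n)) (hθK : ∀ n, tsupport (θ n) ⊆ K) (hC : ∀ n x, ‖θ n x‖ ≤ C)
    (hC' : ∀ n x, ‖fderiv ℝ (θ n) x‖ ≤ C) (hlim : ∀ x, Tendsto (fun n => θ n x) atTop (𝓝 (η x)))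
    (hlim' : ∀ x, Tendsto (fun n => fderiv ℝ (θ n) x) atTop (𝓝 (fderiv ℝ η x))) :
    Tendsto (fun n => ∫ x, schrodingerForm m V E f (θ n) x) atTop
      (𝓝 (∫ x, schrodingerForm m V E f η x)) := by
  have hθs : ∀ n, HasCompactSupport (θ n) := fun n =>
    hK.of_isClosed_subset (isClosed_tsupport _) (hθK n)
  have hf' : Continuous fun x => ∑ a, ‖((1 / (2 * m a) : ℝ) : ℂ)‖ * (3 * ‖fderiv ℝ f x‖) := by
    have := hf.continuous_fderiv one_ne_zero
    fun_prop
  refine tendsto_integral_of_dominated_on hK.measurableSet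
    (.of_forall fun n => (integrable_schrodingerForm hV hf (hθ n) (hθs n)).aestronglyMeasurable)
    (Integrable.mul_const ?_ C)
    (.of_forall fun n x _ => norm_schrodingerForm_le f (hC n x) (hC' n x))
    (.of_forall fun n x hx =>
      schrodingerForm_eq_zero_of_notMem_tsupport f fun hx' => hx (hθK n hx'))
    fun x => tendsto_schrodingerForm f (hlim x) (hlim' x)
  exact ((locallyIntegrable_potential_mul hV hf.continuous).integrableOn_isCompact hK).norm.add
    (hf'.continuousOn.integrableOn_compact hK)

theorem IsSchrodingerViolation.integral_schrodingerForm (hV : LocallyIntegrable V volume)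
    (h : IsSchrodingerViolation m V E f g) (hη : ContDiff ℝ 1 η) (hs : HasCompactSupport η) :
    ∫ x, schrodingerForm m V E f η x = ∫ x, g x * η x := by
  obtain ⟨hf, hg, htest⟩ := h
  obtain ⟨θ, K, C, hK, hθ, hθK, hC, hC', hlim, hlim'⟩ := exists_contDiff_tendsto_fderiv hη hs
  have hform := tendsto_integral_schrodingerForm (m := m) (E := E) hV hf hK
    (fun n => (hθ n).of_le (by exact_mod_cast le_top)) hθK hC hC' hlim hlim'
  have hsource : Tendsto (fun n => ∫ x, g x * θ n x) atTop (𝓝 (∫ x, g x * η x)) := by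
    refine tendsto_integral_of_dominated_on hK.measurableSet
      (.of_forall fun n => hg.aestronglyMeasurable.mul (hθ n).continuous.aestronglyMeasurable)
      ((hg.integrableOn_isCompact hK).norm.mul_const C) (.of_forall fun n x _ => ?_)
      (.of_forall fun n x hx => ?_) fun x => (hlim x).const_mul _
    · rw [norm_mul]
      exact mul_le_mul_of_nonneg_left (hC n x) (norm_nonneg _)
    · rw [image_eq_zero_of_notMem_tsupport fun hx' => hx (hθK n hx'), mul_zero]
  exact tendsto_nhds_unique hform (hsource.congr fun n => (htest (θ n) (hθ n)
    (hK.of_isClosed_subset (isClosed_tsupport _) (hθK n))).symm)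

theorem schrodingerForm_conj (hf : ContDiff ℝ 1 f) (hη : ContDiff ℝ 1 η) (x : Config A) :
    schrodingerForm m V E (fun x => conj (f x)) (fun x => conj (η x)) x
      = conj (schrodingerForm m V E f η x) := by
  simp only [schrodingerForm, map_sub, map_mul, map_sum, gradDot, partialDeriv_conj hf,
    partialDeriv_conj hη, Complex.conj_ofReal]

theorem schrodingerForm_sub_left {f₁ f₂ : Config A → ℂ} (hf₁ : ContDiff ℝ 1 f₁)
    (hf₂ : ContDiff ℝ 1 f₂) (η : Config A → ℂ) (x : Config A) :
    schrodingerForm m V E (fun x => f₁ x - f₂ x) η x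
      = schrodingerForm m V E f₁ η x - schrodingerForm m V E f₂ η x := by
  simp only [schrodingerForm, gradDot, partialDeriv_sub hf₁ hf₂, sub_mul, mul_sub,
    Finset.sum_sub_distrib]
  ring

theorem schrodingerForm_mul_sub_schrodingerForm_mul (hf : ContDiff ℝ 1 f) (hφ : ContDiff ℝ 1 φ)
    (hη : ContDiff ℝ 1 η) (x : Config A) :
    schrodingerForm m V E φ (fun x => f x * η x) x - schrodingerForm m V E f (fun x => φ x * η x) x
      = ∑ a, ((1 / (2 * m a) : ℝ) : ℂ) * (φ x * gradDot a f η x - f x * gradDot a φ η x) := by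
  simp only [schrodingerForm, gradDot_mul_right hf hη, gradDot_mul_right hφ hη,
    gradDot_comm _ φ f, mul_add, mul_sub, Finset.sum_add_distrib, Finset.sum_sub_distrib]
  ring

theorem IsSchrodingerViolation.conj (h : IsSchrodingerViolation m V E f g) :
    IsSchrodingerViolation m V E (fun x => conj (f x)) (fun x => conj (g x)) := by
  obtain ⟨hf, hg, htest⟩ := h
  refine ⟨Complex.conjCLE.contDiff.comp hf,
    hg.mono (Complex.continuous_conj.comp_aestronglyMeasurable hg.aestronglyMeasurable)
      (ae_of_all _ fun x => (RCLike.norm_conj _).le), fun η hη hs => ?_⟩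
  let η' : Config A → ℂ := fun x => conj (η x)
  have hη' : ContDiff ℝ ∞ η' := Complex.conjCLE.contDiff.comp hη
  calc ∫ x, schrodingerForm m V E (fun x => conj (f x)) η x
      = ∫ x, conj (schrodingerForm m V E f η' x) := by
        simp only [← schrodingerForm_conj hf (hη'.of_le (by exact_mod_cast le_top)), η',
          Complex.conj_conj]
    _ = conj (∫ x, g x * η' x) := by
        rw [integral_conj]
        exact congrArg _ (htest η' hη' (hs.comp_left (map_zero _)))
    _ = ∫ x, conj (g x) * η x := by
        simp only [← integral_conj, map_mul, η', Complex.conj_conj]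

theorem IsSchrodingerViolation.sub (hV : LocallyIntegrable V volume) {f₁ f₂ g₁ g₂ : Config A → ℂ}
    (h₁ : IsSchrodingerViolation m V E f₁ g₁) (h₂ : IsSchrodingerViolation m V E f₂ g₂) :
    IsSchrodingerViolation m V E (fun x => f₁ x - f₂ x) (fun x => g₁ x - g₂ x) := by
  obtain ⟨hf₁, hg₁, htest₁⟩ := h₁
  obtain ⟨hf₂, hg₂, htest₂⟩ := h₂
  refine ⟨hf₁.sub hf₂, hg₁.sub hg₂, fun η hη hs => ?_⟩
  have hη₁ : ContDiff ℝ 1 η := hη.of_le (by exact_mod_cast le_top)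
  calc ∫ x, schrodingerForm m V E (fun x => f₁ x - f₂ x) η x
      = (∫ x, schrodingerForm m V E f₁ η x) - ∫ x, schrodingerForm m V E f₂ η x := by
        simp only [schrodingerForm_sub_left hf₁ hf₂]
        exact integral_sub (integrable_schrodingerForm hV hf₁ hη₁ hs)
          (integrable_schrodingerForm hV hf₂ hη₁ hs)
    _ = (∫ x, g₁ x * η x) - ∫ x, g₂ x * η x :=
        congrArg₂ (· - ·) (htest₁ η hη hs) (htest₂ η hη hs)
    _ = ∫ x, (g₁ x - g₂ x) * η x := by
        simp only [sub_mul]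
        exact (integral_sub (hg₁.integrable_smul_right_of_hasCompactSupport hη.continuous hs)
          (hg₂.integrable_smul_right_of_hasCompactSupport hη.continuous hs)).symm

theorem integrable_current (hf : ContDiff ℝ 1 f) (hφ : ContDiff ℝ 1 φ) (hη : ContDiff ℝ 1 η)
    (hs : HasCompactSupport η) (a : Fin A) :
    Integrable (fun x => φ x * gradDot a f η x - f x * gradDot a φ η x) volume :=
  Continuous.integrable_of_hasCompactSupport
    ((hφ.continuous.mul (continuous_gradDot hf hη a)).sub
      (hf.continuous.mul (continuous_gradDot hφ hη a)))
    ((hasCompactSupport_gradDot hs a f).mul_left.sub (hasCompactSupport_gradDot hs a φ).mul_left)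

theorem IsSchrodingerViolation.sum_integral_current (hV : LocallyIntegrable V volume)
    (hf : IsSchrodingerViolation m V E f gf) (hφ : IsSchrodingerViolation m V E φ gφ)
    (hη : ContDiff ℝ 1 η) (hs : HasCompactSupport η) :
    ∑ a : Fin A, ((1 / (2 * m a) : ℝ) : ℂ) *
        ∫ x, (φ x * gradDot a f η x - f x * gradDot a φ η x)
      = ∫ x, (gφ x * f x - gf x * φ x) * η x := by
  have hfη : ContDiff ℝ 1 fun x => f x * η x := hf.1.mul hη
  have hφη : ContDiff ℝ 1 fun x => φ x * η x := hφ.1.mul hη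
  have hgφ : Integrable (fun x => gφ x * (f x * η x)) volume :=
    hφ.2.1.integrable_smul_right_of_hasCompactSupport hfη.continuous hs.mul_left
  have hgf : Integrable (fun x => gf x * (φ x * η x)) volume :=
    hf.2.1.integrable_smul_right_of_hasCompactSupport hφη.continuous hs.mul_left
  calc ∑ a : Fin A, ((1 / (2 * m a) : ℝ) : ℂ) *
        ∫ x, (φ x * gradDot a f η x - f x * gradDot a φ η x)
      = ∫ x, ∑ a : Fin A, ((1 / (2 * m a) : ℝ) : ℂ) *
          (φ x * gradDot a f η x - f x * gradDot a φ η x) := by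
        rw [integral_finsetSum _ fun a _ => (integrable_current hf.1 hφ.1 hη hs a).const_mul _]
        simp only [integral_const_mul]
    _ = (∫ x, schrodingerForm m V E φ (fun x => f x * η x) x)
          - ∫ x, schrodingerForm m V E f (fun x => φ x * η x) x := by
        simp only [← schrodingerForm_mul_sub_schrodingerForm_mul (V := V) (E := E) hf.1 hφ.1 hη]
        exact integral_sub (integrable_schrodingerForm hV hφ.1 hfη hs.mul_left)
          (integrable_schrodingerForm hV hf.1 hφη hs.mul_left)
    _ = (∫ x, gφ x * (f x * η x)) - ∫ x, gf x * (φ x * η x) := by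
        rw [hφ.integral_schrodingerForm hV hfη hs.mul_left,
          hf.integral_schrodingerForm hV hφη hs.mul_left]
    _ = ∫ x, (gφ x * f x - gf x * φ x) * η x := by
        rw [← integral_sub hgφ hgf]
        simp only [sub_mul, mul_assoc]

end WeakForm

section PolarCoordinates

variable {G : Type*} [NormedAddCommGroup G] [NormedSpace ℝ G]

theorem integral_volumeIoiPow (n : ℕ) (f : ℝ → G) :
    ∫ r : Set.Ioi (0 : ℝ), f r ∂Measure.volumeIoiPow n = ∫ r in Set.Ioi (0 : ℝ), r ^ n • f r := by
  simp only [Measure.volumeIoiPow, ENNReal.ofReal]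
  rw [integral_withDensity_eq_integral_smul (by fun_prop),
    integral_subtype_comap measurableSet_Ioi fun r : ℝ => Real.toNNReal (r ^ n) • f r]
  refine setIntegral_congr_fun measurableSet_Ioi fun r hr => ?_
  simp only [NNReal.smul_def, Real.coe_toNNReal _ (pow_nonneg (Set.mem_Ioi.1 hr).le n)]

theorem integral_eq_integral_Ioi_integral_sphere {X : Type*} [NormedAddCommGroup X]
    [NormedSpace ℝ X] [FiniteDimensional ℝ X] [Nontrivial X] [MeasurableSpace X] [BorelSpace X]
    {μ : Measure X} [μ.IsAddHaarMeasure] {f : X → G} (hf : Integrable f μ) :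
    ∫ p, f p ∂μ = ∫ r in Set.Ioi (0 : ℝ), r ^ (Module.finrank ℝ X - 1) •
      ∫ n : Metric.sphere (0 : X) 1, f (r • (n : X)) ∂μ.toSphere := by
  have hpres := μ.measurePreserving_homeomorphUnitSphereProd
  have hemb := (homeomorphUnitSphereProd X).measurableEmbedding
  let F : Metric.sphere (0 : X) 1 × Set.Ioi (0 : ℝ) → G := fun q => f ((q.2 : ℝ) • (q.1 : X))
  have hF : ∀ x : ({0}ᶜ : Set X), F (homeomorphUnitSphereProd X x) = f x := fun x => by
    simp only [F, ← homeomorphUnitSphereProd_symm_apply_coe, Homeomorph.symm_apply_apply]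
  have hFint : Integrable F (μ.toSphere.prod (.volumeIoiPow (Module.finrank ℝ X - 1))) := by
    have hf' : IntegrableOn f ({0}ᶜ : Set X) μ := hf.integrableOn
    rw [integrableOn_iff_comap_subtypeVal (measurableSet_singleton _).compl] at hf'
    rw [← hpres.integrable_comp_emb hemb]
    exact hf'.congr (ae_of_all _ fun x => (hF x).symm)
  calc ∫ p, f p ∂μ = ∫ x : ({0}ᶜ : Set X), f x ∂(μ.comap Subtype.val) := by
        rw [integral_subtype_comap (measurableSet_singleton _).compl fun x => f x,
          restrict_compl_singleton]
    _ = ∫ q, F q ∂(μ.toSphere.prod (.volumeIoiPow (Module.finrank ℝ X - 1))) := by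
        simp only [← hpres.integral_comp hemb, hF]
    _ = ∫ r : Set.Ioi (0 : ℝ), ∫ n : Metric.sphere (0 : X) 1, f ((r : ℝ) • (n : X))
          ∂μ.toSphere ∂(.volumeIoiPow (Module.finrank ℝ X - 1)) := integral_prod_symm _ hFint
    _ = _ := integral_volumeIoiPow _ fun r => ∫ n : Metric.sphere (0 : X) 1,
          f (r • (n : X)) ∂μ.toSphere

end PolarCoordinates

section Place

variable (a : Fin A) (p : Space) (y : Others a)

theorem place_apply_self : place a p y a = p :=
  dif_pos rfl

theorem place_apply_ne (b : {b : Fin A // b ≠ a}) : place a p y b = y b :=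
  dif_neg b.2

theorem place_eq_add_single : place a p y = place a 0 y + Pi.single a p := by
  funext b
  by_cases h : b = a
  · subst h
    simp [place]
  · simp [place, h]

theorem hasFDerivAt_place :
    HasFDerivAt (fun p => place a p y)
      (ContinuousLinearMap.single ℝ (fun _ : Fin A => Space) a) p :=
  ((ContinuousLinearMap.single ℝ (fun _ : Fin A => Space) a).hasFDerivAt.const_add
    (place a 0 y)).congr_of_eventuallyEq (.of_forall fun q => place_eq_add_single a q y)

theorem partialDeriv_place {f : Config A → ℂ} (hf : DifferentiableAt ℝ f (place a p y))
    (v : Space) :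
    partialDeriv a v f (place a p y) = fderiv ℝ (fun q => f (place a q y)) p v :=
  congrArg (fun L => L v) (hf.hasFDerivAt.comp p (hasFDerivAt_place a p y)).fderiv.symm

theorem continuous_place : Continuous fun q : Space × Others a => place a q.1 q.2 := by
  refine continuous_pi fun b => ?_
  by_cases h : b = a <;> simp only [place, h, dite_true, dite_false] <;> fun_prop

theorem measurePreserving_place :
    MeasurePreserving (fun q : Space × Others a => place a q.1 q.2) volume volume := by
  have hsplit : MeasurePreserving (MeasurableEquiv.piEquivPiSubtypeProd (fun _ : Fin A => Space)
      (fun b => b = a)).symm (volume : Measure (({b : Fin A // b = a} → Space) × Others a))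
      volume := by
    convert (volume_preserving_piEquivPiSubtypeProd (fun _ : Fin A => Space)
      (fun b => b = a)).symm <;> rfl
  have hunique : MeasurePreserving
      (Prod.map (MeasurableEquiv.funUnique {b : Fin A // b = a} Space).symm
        (id : Others a → Others a)) volume volume :=
    (volume_preserving_funUnique {b : Fin A // b = a} Space).symm.prod (MeasurePreserving.id volume)
  exact MeasurePreserving.comp (g := (MeasurableEquiv.piEquivPiSubtypeProd
    (fun _ : Fin A => Space) (fun b => b = a)).symm) hsplit hunique

theorem integral_eq_integral_place_sphere {G : Type*} [NormedAddCommGroup G] [NormedSpace ℝ G]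
    {F : Config A → G} (hF : Integrable F volume) :
    ∫ x, F x = ∫ y : Others a, ∫ r in Set.Ioi (0 : ℝ), r ^ 2 •
      ∫ n : Metric.sphere (0 : Space) 1, F (place a (r • (n : Space)) y)
        ∂(volume : Measure Space).toSphere := by
  have hpres := measurePreserving_place a
  have hF' : Integrable (fun q : Space × Others a => F (place a q.1 q.2)) volume :=
    hpres.integrable_comp_of_integrable hF
  calc ∫ x, F x = ∫ q : Space × Others a, F (place a q.1 q.2) := by
        have hFm := hF.aestronglyMeasurable
        rw [← hpres.map_eq] at hFm
        rw [← hpres.map_eq, integral_map hpres.measurable.aemeasurable hFm]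
    _ = ∫ y : Others a, ∫ p, F (place a p y) := integral_prod_symm _ hF'
    _ = _ := integral_congr_ae <| hF'.prod_left_ae.mono fun y hy => by
        simp only [integral_eq_integral_Ioi_integral_sphere hy, finrank_euclideanSpace,
          Fintype.card_fin, Nat.add_one_sub_one]

end Place

section RadialCutoff

variable {κ : ℝ → ℝ} {c : ℝ}

theorem hasFDerivAt_norm {G : Type*} [NormedAddCommGroup G] [InnerProductSpace ℝ G] {p : G}
    (hp : p ≠ 0) : HasFDerivAt (fun q : G => ‖q‖) (innerSL ℝ (‖p‖⁻¹ • p)) p := by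
  have h := (hasStrictFDerivAt_norm_sq p).hasFDerivAt.sqrt (pow_ne_zero 2 (norm_ne_zero_iff.2 hp))
  simp only [Real.sqrt_sq (norm_nonneg _)] at h
  refine h.congr_fderiv (ContinuousLinearMap.ext fun v => ?_)
  simp only [smul_apply, innerSL_apply_apply, real_inner_smul_left, smul_eq_mul, nsmul_eq_mul]
  push_cast
  field_simp

theorem fderiv_comp_norm {G : Type*} [NormedAddCommGroup G] [InnerProductSpace ℝ G] {p : G}
    (hp : p ≠ 0) (hκ : DifferentiableAt ℝ κ ‖p‖) (v : G) :
    fderiv ℝ (fun q : G => κ ‖q‖) p v = deriv κ ‖p‖ * inner ℝ (‖p‖⁻¹ • p) v :=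
  congrArg (fun L => L v) (hκ.hasDerivAt.comp_hasFDerivAt p (hasFDerivAt_norm hp)).fderiv

theorem contDiff_comp_norm {G : Type*} [NormedAddCommGroup G] [InnerProductSpace ℝ G]
    {n : WithTop ℕ∞} (hκ : ContDiff ℝ n κ) (hc : ∀ᶠ r in 𝓝 0, κ r = c) :
    ContDiff ℝ n fun p : G => κ ‖p‖ := by
  refine contDiff_iff_contDiffAt.2 fun p => ?_
  rcases eq_or_ne p 0 with rfl | hp
  · have hc' : ∀ᶠ p : G in 𝓝 0, κ ‖p‖ = c :=
      (continuous_norm.tendsto' 0 0 norm_zero).eventually hc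
    exact contDiffAt_const.congr_of_eventuallyEq hc'
  · exact hκ.contDiffAt.comp p (contDiffAt_norm ℝ hp)

/-- The product `∏_b κ(|x_b|)`, used with a profile `κ` that cuts off large arguments. It is
complex-valued so as to serve as a test function. -/
noncomputable def radialCutoff {ι G : Type*} [Fintype ι] [Norm G] (κ : ℝ → ℝ) (x : ι → G) : ℂ :=
  ((∏ b, κ ‖x b‖ : ℝ) : ℂ)

theorem radialCutoff_eq_zero {ι G : Type*} [Fintype ι] [Norm G] {x : ι → G} {b : ι}
    (hb : κ ‖x b‖ = 0) : radialCutoff κ x = 0 := by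
  rw [radialCutoff, Finset.prod_eq_zero (Finset.mem_univ b) hb, Complex.ofReal_zero]

theorem continuous_radialCutoff {ι G : Type*} [Fintype ι] [SeminormedAddCommGroup G]
    (hκ : Continuous κ) : Continuous (radialCutoff κ : (ι → G) → ℂ) := by
  unfold radialCutoff
  fun_prop

theorem radialCutoff_eq_zero_of_notMem_closedBall {ι G : Type*} [Fintype ι]
    [SeminormedAddCommGroup G] {R : ℝ} (hR : 0 ≤ R) (hzero : ∀ r, R ≤ r → κ r = 0) {x : ι → G}
    (hx : x ∉ Metric.closedBall 0 R) : radialCutoff κ x = 0 := by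
  rw [mem_closedBall_zero_iff, pi_norm_le_iff_of_nonneg hR] at hx
  push Not at hx
  obtain ⟨b, hb⟩ := hx
  exact radialCutoff_eq_zero (hzero _ hb.le)

theorem hasCompactSupport_radialCutoff {ι G : Type*} [Fintype ι] [SeminormedAddCommGroup G]
    [ProperSpace G] {R : ℝ} (hR : 0 ≤ R) (hzero : ∀ r, R ≤ r → κ r = 0) :
    HasCompactSupport (radialCutoff κ : (ι → G) → ℂ) :=
  HasCompactSupport.intro' (isCompact_closedBall 0 R) Metric.isClosed_closedBall
    fun _ => radialCutoff_eq_zero_of_notMem_closedBall hR hzero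

theorem contDiff_radialCutoff {ι G : Type*} [Fintype ι] [NormedAddCommGroup G]
    [InnerProductSpace ℝ G] {n : WithTop ℕ∞} (hκ : ContDiff ℝ n κ)
    (hc : ∀ᶠ r in 𝓝 0, κ r = c) : ContDiff ℝ n (radialCutoff κ : (ι → G) → ℂ) :=
  Complex.ofRealCLM.contDiff.comp <| contDiff_prod fun b _ =>
    (contDiff_comp_norm hκ hc).comp (contDiff_apply ℝ G b)

theorem radialCutoff_place (κ : ℝ → ℝ) (a : Fin A) (p : Space) (y : Others a) :
    radialCutoff κ (place a p y) = radialCutoff κ y * (κ ‖p‖ : ℂ) := by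
  rw [radialCutoff, radialCutoff, Fintype.prod_eq_mul_prod_subtype_ne _ a, place_apply_self]
  simp only [place_apply_ne, Complex.ofReal_mul, mul_comm]

theorem partialDeriv_radialCutoff (hκ : ContDiff ℝ 1 κ) (hc : ∀ᶠ r in 𝓝 0, κ r = c) (a : Fin A)
    {p : Space} (hp : p ≠ 0) (y : Others a) (v : Space) :
    partialDeriv a v (radialCutoff κ) (place a p y)
      = radialCutoff κ y * ((deriv κ ‖p‖ * inner ℝ (‖p‖⁻¹ • p) v : ℝ) : ℂ) := by
  have hd : HasFDerivAt (fun q : Space => κ ‖q‖) _ p :=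
    ((contDiff_comp_norm hκ hc).differentiable one_ne_zero p).hasFDerivAt
  rw [partialDeriv_place a p y ((contDiff_radialCutoff hκ hc).differentiable one_ne_zero _),
    ← fderiv_comp_norm hp (hκ.differentiable one_ne_zero _)]
  simp only [radialCutoff_place]
  exact congrArg (fun L => L v)
    ((Complex.ofRealCLM.hasFDerivAt.comp p hd).const_mul (radialCutoff κ y)).fderiv

theorem gradDot_radialCutoff (hκ : ContDiff ℝ 1 κ) (hc : ∀ᶠ r in 𝓝 0, κ r = c) (f : Config A → ℂ)
    (a : Fin A) {p : Space} (hp : p ≠ 0) (y : Others a) :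
    gradDot a f (radialCutoff κ) (place a p y)
      = radialCutoff κ y * ((deriv κ ‖p‖ : ℝ) : ℂ) *
        partialDeriv a (‖p‖⁻¹ • p) f (place a p y) := by
  rw [← sum_partialDeriv_mul_coord f a, Finset.mul_sum]
  refine Finset.sum_congr rfl fun j _ => ?_
  rw [partialDeriv_radialCutoff hκ hc a hp, EuclideanSpace.inner_single_right]
  simp only [PiLp.smul_apply, smul_eq_mul, Real.ringHom_apply, one_mul, Complex.ofReal_mul]
  ring

end RadialCutoff

section Current

variable {ξ φ : Config A → ℂ}

/-- The sesquilinear Wronskian density `ξ^* ∂ₙφ - (∂ₙξ^*) φ` of particle `a` in the direction `n`,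
whose integral over the sphere `|x_a| = R` is `surfaceTerm ξ φ a R`. -/
noncomputable def wronskian (ξ φ : Config A → ℂ) (a : Fin A) (n : Space) (x : Config A) : ℂ :=
  conj (ξ x) * partialDeriv a n φ x - conj (partialDeriv a n ξ x) * φ x

theorem continuous_wronskian (hξ : ContDiff ℝ 1 ξ) (hφ : ContDiff ℝ 1 φ) (a : Fin A) :
    Continuous fun q : Space × Config A => wronskian ξ φ a q.1 q.2 :=
  ((Complex.continuous_conj.comp (hξ.continuous.comp continuous_snd)).mul
      (continuous_partialDeriv hφ a)).sub
    ((Complex.continuous_conj.comp (continuous_partialDeriv hξ a)).mul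
      (hφ.continuous.comp continuous_snd))

theorem surfaceTerm_eq_integral_wronskian (ξ φ : Config A → ℂ) (a : Fin A) (R : ℝ)
    (y : Others a) :
    surfaceTerm ξ φ a R y = ((R ^ 2 : ℝ) : ℂ) * ∫ n : Metric.sphere (0 : Space) 1,
      wronskian ξ φ a n (place a (R • (n : Space)) y) ∂(volume : Measure Space).toSphere :=
  rfl

theorem continuous_surfaceTerm (hξ : ContDiff ℝ 1 ξ) (hφ : ContDiff ℝ 1 φ) (a : Fin A) :
    Continuous fun q : ℝ × Others a => surfaceTerm ξ φ a q.1 q.2 := by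
  have hw : Continuous (Function.uncurry fun (q : ℝ × Others a)
      (n : Metric.sphere (0 : Space) 1) => wronskian ξ φ a n (place a (q.1 • (n : Space)) q.2)) :=
    (continuous_wronskian hξ hφ a).comp <| Continuous.prodMk (by fun_prop) <|
      (continuous_place a).comp (by fun_prop : Continuous fun p : (ℝ × Others a) ×
        Metric.sphere (0 : Space) 1 => (p.1.1 • (p.2 : Space), p.1.2))
  have hint := continuous_parametric_integral_of_continuous
    (μ := (volume : Measure Space).toSphere) hw isCompact_univ
  simp only [Measure.restrict_univ] at hint
  exact (by fun_prop : Continuous fun q : ℝ × Others a => ((q.1 ^ 2 : ℝ) : ℂ)).mul hint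

theorem current_radialCutoff_place {κ : ℝ → ℝ} {c : ℝ} (hκ : ContDiff ℝ 1 κ)
    (hc : ∀ᶠ r in 𝓝 0, κ r = c) (hξ : ContDiff ℝ 1 ξ) (φ : Config A → ℂ) (a : Fin A) {r : ℝ}
    (hr : 0 < r) (n : Metric.sphere (0 : Space) 1) (y : Others a) :
    φ (place a (r • (n : Space)) y) *
          gradDot a (fun x => conj (ξ x)) (radialCutoff κ) (place a (r • (n : Space)) y)
        - conj (ξ (place a (r • (n : Space)) y)) *
          gradDot a φ (radialCutoff κ) (place a (r • (n : Space)) y)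
      = radialCutoff κ y * ((-deriv κ r : ℝ) : ℂ) *
        wronskian ξ φ a n (place a (r • (n : Space)) y) := by
  have hn : ‖(n : Space)‖ = 1 := norm_eq_of_mem_sphere n
  have hrn : ‖r • (n : Space)‖ = r := by rw [norm_smul, hn, mul_one, Real.norm_of_nonneg hr.le]
  have hne : r • (n : Space) ≠ 0 := norm_ne_zero_iff.1 (hrn.trans_ne hr.ne')
  rw [gradDot_radialCutoff hκ hc _ a hne, gradDot_radialCutoff hκ hc _ a hne, hrn,
    inv_smul_smul₀ hr.ne', partialDeriv_conj hξ, wronskian, Complex.ofReal_neg]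
  ring

theorem integral_current_radialCutoff {κ : ℝ → ℝ} {c R : ℝ} (hκ : ContDiff ℝ 1 κ)
    (hc : ∀ᶠ r in 𝓝 0, κ r = c) (hR : 0 ≤ R) (hzero : ∀ r, R ≤ r → κ r = 0)
    (hξ : ContDiff ℝ 1 ξ) (hφ : ContDiff ℝ 1 φ) (a : Fin A) :
    ∫ x, (φ x * gradDot a (fun x => conj (ξ x)) (radialCutoff κ) x
        - conj (ξ x) * gradDot a φ (radialCutoff κ) x)
      = ∫ y : Others a, radialCutoff κ y *
          ∫ r in Set.Ioi (0 : ℝ), ((-deriv κ r : ℝ) : ℂ) * surfaceTerm ξ φ a r y := by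
  have hξ' : ContDiff ℝ 1 fun x => conj (ξ x) := Complex.conjCLE.contDiff.comp hξ
  have hχ : ContDiff ℝ 1 (radialCutoff κ : Config A → ℂ) := contDiff_radialCutoff hκ hc
  have hχs : HasCompactSupport (radialCutoff κ : Config A → ℂ) :=
    hasCompactSupport_radialCutoff hR hzero
  rw [integral_eq_integral_place_sphere a (integrable_current hξ' hφ hχ hχs a)]
  refine integral_congr_ae (ae_of_all _ fun y => ?_)
  simp only [← integral_const_mul (radialCutoff κ y)]
  refine setIntegral_congr_fun measurableSet_Ioi fun r hr => ?_
  simp only [current_radialCutoff_place hκ hc hξ φ a (Set.mem_Ioi.1 hr), integral_const_mul,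
    Complex.real_smul, surfaceTerm_eq_integral_wronskian]
  ring

end Current

section BallProd

/-- The product `{x | ∀ b, |x_b| < R}` of open balls, the box of configurations that exhausts
configuration space as `R → ∞`. -/
def ballProd (ι G : Type*) [Norm G] (R : ℝ) : Set (ι → G) :=
  {x | ∀ b, ‖x b‖ < R}

theorem isOpen_ballProd {ι G : Type*} [Finite ι] [SeminormedAddCommGroup G] (R : ℝ) :
    IsOpen (ballProd ι G R) := by
  simp only [ballProd, Set.ofPred_forall]
  exact isOpen_iInter_of_finite fun b => isOpen_lt (continuous_apply b).norm continuous_const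

theorem aecover_ballProd {ι G : Type*} [Finite ι] [SeminormedAddCommGroup G]
    [MeasurableSpace (ι → G)] [OpensMeasurableSpace (ι → G)] (μ : Measure (ι → G)) :
    AECover μ atTop (ballProd ι G) where
  ae_eventually_mem := ae_of_all _ fun _ => eventually_all.2 fun _ => eventually_gt_atTop _
  measurableSet R := (isOpen_ballProd R).measurableSet

end BallProd

section Profile

open Real (smoothTransition)

/-- A smooth profile that is `1` on `(-∞, R - ε]` and `0` on `[R, ∞)`, for `ε > 0`. -/
noncomputable def profile (R ε r : ℝ) : ℝ :=
  smoothTransition ((R - r) / ε)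

variable {R ε r : ℝ}

theorem contDiff_profile {n : WithTop ℕ∞} (hn : n ≤ ∞) : ContDiff ℝ n (profile R ε) :=
  (smoothTransition.contDiff.of_le hn).comp (by fun_prop)

theorem profile_eq_one (hε : 0 < ε) (hr : r ≤ R - ε) : profile R ε r = 1 :=
  smoothTransition.one_of_one_le ((one_le_div hε).2 (by linarith))

theorem profile_eq_zero (hε : 0 < ε) (hr : R ≤ r) : profile R ε r = 0 :=
  smoothTransition.zero_of_nonpos (div_nonpos_of_nonpos_of_nonneg (by linarith) hε.le)

theorem profile_nonneg (R ε r : ℝ) : 0 ≤ profile R ε r := smoothTransition.nonneg _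

theorem profile_le_one (R ε r : ℝ) : profile R ε r ≤ 1 := smoothTransition.le_one _

theorem deriv_profile (R ε r : ℝ) :
    deriv (profile R ε) r = -(ε⁻¹ * deriv smoothTransition ((R - r) / ε)) := by
  have hs : HasDerivAt smoothTransition _ ((R - r) / ε) :=
    ((smoothTransition.contDiff (n := 1)).differentiable one_ne_zero _).hasDerivAt
  have hlin : HasDerivAt (fun r : ℝ => (R - r) / ε) (-1 / ε) r :=
    ((hasDerivAt_id r).const_sub R).div_const ε
  refine (hs.comp r hlin).deriv.trans ?_
  ring

theorem deriv_profile_of_le (hε : 0 < ε) (hr : r ≤ R - ε) : deriv (profile R ε) r = 0 :=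
  IsLocalMax.deriv_eq_zero (.of_forall fun s => by
    rw [profile_eq_one hε hr]
    exact profile_le_one R ε s)

theorem deriv_profile_of_ge (hε : 0 < ε) (hr : R ≤ r) : deriv (profile R ε) r = 0 :=
  IsLocalMin.deriv_eq_zero (.of_forall fun s => by
    rw [profile_eq_zero hε hr]
    exact profile_nonneg R ε s)

theorem continuous_deriv_smoothTransition : Continuous (deriv smoothTransition) :=
  (smoothTransition.contDiff (n := 1)).continuous_deriv le_rfl

theorem integral_deriv_smoothTransition : ∫ s in (0 : ℝ)..1, deriv smoothTransition s = 1 := by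
  rw [intervalIntegral.integral_deriv_eq_sub
      (fun s _ => (smoothTransition.contDiff (n := 1)).differentiable one_ne_zero s)
      (continuous_deriv_smoothTransition.intervalIntegrable _ _),
    smoothTransition.one, smoothTransition.zero, sub_zero]

theorem integral_deriv_profile_mul (hε : 0 < ε) (hεR : ε ≤ R) (w : ℝ → ℂ) :
    ∫ r in Set.Ioi (0 : ℝ), ((-deriv (profile R ε) r : ℝ) : ℂ) * w r
      = ∫ s in (0 : ℝ)..1, ((deriv smoothTransition s : ℝ) : ℂ) * w (R - ε * s) := by
  have hpull : ∀ s, ((-deriv (profile R ε) (R - ε * s) : ℝ) : ℂ)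
      = (ε⁻¹ : ℝ) * ((deriv smoothTransition s : ℝ) : ℂ) := fun s => by
    rw [deriv_profile, neg_neg, sub_sub_cancel, mul_div_cancel_left₀ s hε.ne', Complex.ofReal_mul]
  have hsub : Set.Ioc (R - ε) R ⊆ Set.Ioi 0 := fun r hr => (sub_nonneg.2 hεR).trans_lt hr.1
  calc ∫ r in Set.Ioi (0 : ℝ), ((-deriv (profile R ε) r : ℝ) : ℂ) * w r
      = ∫ r in Set.Ioc (R - ε) R, ((-deriv (profile R ε) r : ℝ) : ℂ) * w r := by
        refine setIntegral_eq_of_subset_of_forall_sdiff_eq_zero measurableSet_Ioi hsub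
          fun r hr => ?_
        have hderiv : deriv (profile R ε) r = 0 := by
          rcases le_or_gt r (R - ε) with hr' | hr'
          · exact deriv_profile_of_le hε hr'
          · exact deriv_profile_of_ge hε (not_le.1 fun h => hr.2 ⟨hr', h⟩).le
        rw [hderiv, neg_zero, Complex.ofReal_zero, zero_mul]
    _ = ε • ∫ s in (0 : ℝ)..1, ((-deriv (profile R ε) (R - ε * s) : ℝ) : ℂ) * w (R - ε * s) := by
        rw [intervalIntegral.smul_integral_comp_sub_mul
            (fun r => ((-deriv (profile R ε) r : ℝ) : ℂ) * w r), mul_one, mul_zero, sub_zero,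
          intervalIntegral.integral_of_le (by linarith)]
    _ = ∫ s in (0 : ℝ)..1, ((deriv smoothTransition s : ℝ) : ℂ) * w (R - ε * s) := by
        simp only [hpull, mul_assoc, intervalIntegral.integral_const_mul, Complex.real_smul]
        rw [← mul_assoc, ← Complex.ofReal_mul, mul_inv_cancel₀ hε.ne', Complex.ofReal_one, one_mul]

end Profile

section SharpCutoff

variable {ι G : Type*} [Fintype ι]

theorem norm_radialCutoff_profile_le [Norm G] (R ε : ℝ) (x : ι → G) :
    ‖radialCutoff (profile R ε) x‖ ≤ 1 := by
  rw [radialCutoff, Complex.norm_real,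
    Real.norm_of_nonneg (Finset.prod_nonneg fun b _ => profile_nonneg _ _ _)]
  exact Finset.prod_le_one (fun b _ => profile_nonneg _ _ _) fun b _ => profile_le_one _ _ _

theorem tendsto_radialCutoff_profile_mul [Norm G] {R : ℝ} {F : ℝ → (ι → G) → ℂ}
    {F₀ : (ι → G) → ℂ} {x : ι → G} (hF : Tendsto (fun ε => F ε x) (𝓝[>] 0) (𝓝 (F₀ x))) :
    Tendsto (fun ε => radialCutoff (profile R ε) x * F ε x) (𝓝[>] 0)
      (𝓝 ((ballProd ι G R).indicator F₀ x)) := by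
  by_cases hx : x ∈ ballProd ι G R
  · rw [Set.indicator_of_mem hx]
    refine hF.congr' ?_
    have hsmall : ∀ b, ∀ᶠ ε in 𝓝[>] (0 : ℝ), ε < R - ‖x b‖ := fun b =>
      nhdsWithin_le_nhds (gt_mem_nhds (sub_pos.2 (hx b)))
    filter_upwards [eventually_all.2 hsmall, self_mem_nhdsWithin] with ε hεx hε
    rw [radialCutoff, Finset.prod_eq_one fun b _ => profile_eq_one hε (by linarith [hεx b]),
      Complex.ofReal_one, one_mul]
  · rw [Set.indicator_of_notMem hx]
    simp only [ballProd, Set.mem_ofPred_eq, not_forall, not_lt] at hx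
    obtain ⟨b, hb⟩ := hx
    refine tendsto_const_nhds.congr' ?_
    filter_upwards [self_mem_nhdsWithin] with ε hε
    rw [radialCutoff_eq_zero (profile_eq_zero hε hb), zero_mul]

theorem tendsto_integral_radialCutoff_profile_mul [SeminormedAddCommGroup G]
    [MeasurableSpace (ι → G)] [OpensMeasurableSpace (ι → G)] {μ : Measure (ι → G)} {R : ℝ}
    (hR : 0 ≤ R) {F : ℝ → (ι → G) → ℂ} {F₀ : (ι → G) → ℂ} {b : (ι → G) → ℝ}
    (hF : ∀ ε, AEStronglyMeasurable (F ε) μ) (hb : IntegrableOn b (Metric.closedBall 0 R) μ)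
    (hle : ∀ᶠ ε in 𝓝[>] 0, ∀ x ∈ Metric.closedBall 0 R, ‖F ε x‖ ≤ b x)
    (hlim : ∀ x, Tendsto (fun ε => F ε x) (𝓝[>] 0) (𝓝 (F₀ x))) :
    Tendsto (fun ε => ∫ x, radialCutoff (profile R ε) x * F ε x ∂μ) (𝓝[>] 0)
      (𝓝 (∫ x in ballProd ι G R, F₀ x ∂μ)) := by
  rw [← integral_indicator (isOpen_ballProd R).measurableSet]
  refine tendsto_integral_of_dominated_on Metric.isClosed_closedBall.measurableSet
    (.of_forall fun ε => ?_) hb ?_ ?_ fun x => tendsto_radialCutoff_profile_mul (hlim x)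
  · have hκ : Continuous (profile R ε) := (contDiff_profile le_rfl).continuous
    exact (continuous_radialCutoff hκ).aestronglyMeasurable.mul (hF ε)
  · filter_upwards [hle] with ε hε x hx
    rw [norm_mul]
    exact (mul_le_of_le_one_left (norm_nonneg _) (norm_radialCutoff_profile_le R ε x)).trans
      (hε x hx)
  · filter_upwards [self_mem_nhdsWithin] with ε hε x hx
    rw [radialCutoff_eq_zero_of_notMem_closedBall hR (fun r => profile_eq_zero hε) hx, zero_mul]

variable {ξ φ : Config A → ℂ}

theorem tendsto_integral_radialCutoff_surfaceTerm (hξ : ContDiff ℝ 1 ξ) (hφ : ContDiff ℝ 1 φ)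
    (a : Fin A) {R : ℝ} (hR : 0 < R) :
    Tendsto (fun ε => ∫ y : Others a, radialCutoff (profile R ε) y *
        ∫ r in Set.Ioi (0 : ℝ), ((-deriv (profile R ε) r : ℝ) : ℂ) * surfaceTerm ξ φ a r y)
      (𝓝[>] 0) (𝓝 (∫ y in ballProd {b // b ≠ a} Space R, surfaceTerm ξ φ a R y)) := by
  let I : ℝ → Others a → ℂ := fun ε y =>
    ∫ s in (0 : ℝ)..1, ((deriv Real.smoothTransition s : ℝ) : ℂ) * surfaceTerm ξ φ a (R - ε * s) y
  have hI : Continuous (Function.uncurry I) := by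
    refine intervalIntegral.continuous_parametric_intervalIntegral_of_continuous' ?_ 0 1
    exact (Complex.continuous_ofReal.comp
        (continuous_deriv_smoothTransition.comp continuous_snd)).mul <|
      (continuous_surfaceTerm hξ hφ a).comp (by fun_prop : Continuous fun p : (ℝ × Others a) × ℝ =>
        (R - p.1.1 * p.2, p.1.2))
  have hI₀ : ∀ y, I 0 y = surfaceTerm ξ φ a R y := fun y => by
    simp only [I, zero_mul, sub_zero, intervalIntegral.integral_mul_const,
      intervalIntegral.integral_ofReal, integral_deriv_smoothTransition, Complex.ofReal_one,
      one_mul]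
  obtain ⟨C, hC⟩ := (isCompact_Icc.prod (isCompact_closedBall (0 : Others a) R)
    ).exists_bound_of_continuousOn (hI.continuousOn (s := Set.Icc 0 R ×ˢ Metric.closedBall 0 R))
  refine (tendsto_integral_radialCutoff_profile_mul hR.le (F := I) (b := fun _ => C)
    (fun ε => (hI.comp (by fun_prop : Continuous fun y => (ε, y))).aestronglyMeasurable)
    (integrableOn_const (isCompact_closedBall _ _).measure_ne_top) ?_ fun y => ?_).congr' ?_
  · filter_upwards [Ioc_mem_nhdsGT hR] with ε hε y hy using hC (ε, y) ⟨⟨hε.1.le, hε.2⟩, hy⟩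
  · rw [← hI₀]
    exact ((hI.comp (by fun_prop : Continuous fun ε : ℝ => (ε, y))).tendsto 0).mono_left
      nhdsWithin_le_nhds
  · filter_upwards [Ioc_mem_nhdsGT hR] with ε hε
    simp only [I, integral_deriv_profile_mul hε.1 hε.2]

end SharpCutoff

section BoundaryTerm

variable {ξ φ g gξ gφ : Config A → ℂ}

theorem IsSchrodingerViolation.sum_integral_surfaceTerm (hV : LocallyIntegrable V volume)
    (hξ : IsSchrodingerViolation m V E ξ gξ) (hφ : IsSchrodingerViolation m V E φ gφ)
    {R : ℝ} (hR : 0 < R) :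
    ∑ a : Fin A, ((1 / (2 * m a) : ℝ) : ℂ) *
        ∫ y in ballProd {b // b ≠ a} Space R, surfaceTerm ξ φ a R y
      = ∫ x in ballProd (Fin A) Space R, (gφ x * conj (ξ x) - conj (gξ x) * φ x) := by
  let u : Config A → ℂ := fun x => gφ x * conj (ξ x) - conj (gξ x) * φ x
  have hu : LocallyIntegrable u volume :=
    (hφ.2.1.smul_continuous hξ.conj.1.continuous).sub
      (hξ.conj.2.1.smul_continuous hφ.1.continuous)
  have hsurface := tendsto_finsetSum Finset.univ fun a _ =>
    (tendsto_integral_radialCutoff_surfaceTerm hξ.1 hφ.1 a hR).const_mul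
      ((1 / (2 * m a) : ℝ) : ℂ)
  have hvolume : Tendsto (fun ε => ∫ x, radialCutoff (profile R ε) x * u x) (𝓝[>] 0)
      (𝓝 (∫ x in ballProd (Fin A) Space R, u x)) :=
    tendsto_integral_radialCutoff_profile_mul hR.le (fun _ => hu.aestronglyMeasurable)
      (hu.integrableOn_isCompact (isCompact_closedBall 0 R)).norm
      (.of_forall fun _ _ _ => le_rfl) fun _ => tendsto_const_nhds
  refine tendsto_nhds_unique (hsurface.congr' ?_) hvolume
  filter_upwards [Ioo_mem_nhdsGT hR] with ε ⟨hε, hεR⟩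
  have hκ : ContDiff ℝ 1 (profile R ε) := contDiff_profile (by exact_mod_cast le_top)
  have hone : ∀ᶠ r in 𝓝 0, profile R ε r = 1 :=
    (gt_mem_nhds (sub_pos.2 hεR)).mono fun r hr => profile_eq_one hε hr.le
  have hzero : ∀ r, R ≤ r → profile R ε r = 0 := fun r => profile_eq_zero hε
  simp only [← integral_current_radialCutoff hκ hone hR.le hzero hξ.1 hφ.1, mul_comm _ (u _)]
  exact hξ.conj.sum_integral_current hV hφ (contDiff_radialCutoff hκ hone)
    (hasCompactSupport_radialCutoff hR.le hzero)

theorem IsEigenstate.sum_integral_surfaceTerm (hV : LocallyIntegrable V volume)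
    (hξ : IsEigenstate m V E ξ) (hφ : IsSchrodingerViolation m V E φ g) (M : ℝ) {R : ℝ}
    (hR : 0 < R) :
    ∑ a : Fin A, ((M / m a : ℝ) : ℂ) *
        ∫ y in ballProd {b // b ≠ a} Space R, surfaceTerm ξ φ a R y
      = ((2 * M : ℝ) : ℂ) * ∫ x in ballProd (Fin A) Space R, g x * conj (ξ x) := by
  have hweight : ∀ a, ((M / m a : ℝ) : ℂ) = ((2 * M : ℝ) : ℂ) * ((1 / (2 * m a) : ℝ) : ℂ) :=
    fun a => by
      rw [← Complex.ofReal_mul, one_div, mul_inv, div_eq_mul_inv]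
      congr 1
      ring
  have hgreen := IsSchrodingerViolation.sum_integral_surfaceTerm hV hξ hφ hR
  simp only [map_zero, zero_mul, sub_zero] at hgreen
  simp only [← hgreen, hweight, Finset.mul_sum, mul_assoc]

theorem integrable_mul_conj (hg : Integrable g volume) (hξ : Continuous ξ)
    (hξb : BddAbove (Set.range fun x => ‖ξ x‖)) :
    Integrable (fun x => g x * conj (ξ x)) volume :=
  hg.mul_bdd (Complex.continuous_conj.comp hξ).aestronglyMeasurable
    (ae_of_all _ fun x => (RCLike.norm_conj _).trans_le (le_ciSup hξb x))

theorem norm_integral_mul_conj_le (hg : Integrable g volume)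
    (hξb : BddAbove (Set.range fun x => ‖ξ x‖)) :
    ‖∫ x, g x * conj (ξ x)‖ ≤ (⨆ x, ‖ξ x‖) * ∫ x, ‖g x‖ := by
  rw [← integral_const_mul]
  refine norm_integral_le_of_norm_le (hg.norm.const_mul _) (ae_of_all _ fun x => ?_)
  rw [norm_mul, RCLike.norm_conj, mul_comm]
  exact mul_le_mul_of_nonneg_right (le_ciSup hξb x) (norm_nonneg _)

theorem IsEigenstate.tendsto_sum_integral_surfaceTerm (hV : LocallyIntegrable V volume)
    (hξ : IsEigenstate m V E ξ) (hξb : BddAbove (Set.range fun x => ‖ξ x‖))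
    (hφ : IsSchrodingerViolation m V E φ g) (hg : Integrable g volume) (M : ℝ) :
    Tendsto (fun R : ℝ => ∑ a : Fin A, ((M / m a : ℝ) : ℂ) *
        ∫ y in ballProd {b // b ≠ a} Space R, surfaceTerm ξ φ a R y) atTop
      (𝓝 (((2 * M : ℝ) : ℂ) * ∫ x, g x * conj (ξ x))) := by
  refine (((aecover_ballProd volume).integral_tendsto_of_countably_generated
    (integrable_mul_conj hg hξ.1.continuous hξb)).const_mul _).congr' ?_
  filter_upwards [eventually_gt_atTop 0] with R hR
  exact (hξ.sum_integral_surfaceTerm hV hφ M hR).symm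

end BoundaryTerm

section DominatedConvergence

variable {α ι G : Type*} [MeasurableSpace α] {μ : Measure α} [NormedAddCommGroup G]
  {l : Filter ι} [l.IsCountablyGenerated] {F : ι → α → G} {F₀ : α → G} {h : α → ℝ}

theorem integrable_of_tendsto_of_dominated [l.NeBot]
    (hF : ∀ i, AEStronglyMeasurable (F i) μ) (hh : Integrable h μ)
    (hle : ∀ᶠ i in l, ∀ᵐ x ∂μ, ‖F i x‖ ≤ h x)
    (hlim : ∀ᵐ x ∂μ, Tendsto (fun i => F i x) l (𝓝 (F₀ x))) : Integrable F₀ μ := by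
  obtain ⟨u, hu⟩ := l.exists_seq_tendsto
  obtain ⟨N, hN⟩ := eventually_atTop.1 (hu.eventually hle)
  have hlimN : ∀ᵐ x ∂μ, Tendsto (fun n => F (u (n + N)) x) atTop (𝓝 (F₀ x)) :=
    hlim.mono fun x hx => hx.comp (hu.comp (tendsto_add_atTop_nat N))
  exact ⟨aestronglyMeasurable_of_tendsto_ae l hF hlim, hasFiniteIntegral_of_dominated_convergence
    hh.hasFiniteIntegral (fun n => hN (n + N) (Nat.le_add_left N n)) hlimN⟩

variable [NormedSpace ℝ G] {B : ι → Set α}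

theorem integrable_and_tendsto_setIntegral_of_dominated [l.NeBot] (hB : AECover μ l B)
    (hF : ∀ i, AEStronglyMeasurable (F i) μ) (hh : Integrable h μ)
    (hle : ∀ᶠ i in l, ∀ᵐ x ∂μ, x ∈ B i → ‖F i x‖ ≤ h x)
    (hlim : ∀ᵐ x ∂μ, Tendsto (fun i => F i x) l (𝓝 (F₀ x))) :
    Integrable F₀ μ ∧ Tendsto (fun i => ∫ x in B i, F i x ∂μ) l (𝓝 (∫ x, F₀ x ∂μ)) := by
  have hmeas : ∀ i, AEStronglyMeasurable ((B i).indicator (F i)) μ := fun i =>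
    (hF i).indicator (hB.measurableSet i)
  have hlim' : ∀ᵐ x ∂μ, Tendsto (fun i => (B i).indicator (F i) x) l (𝓝 (F₀ x)) := by
    filter_upwards [hlim, hB.ae_eventually_mem] with x hx hmem
    exact hx.congr' (hmem.mono fun i hi => (Set.indicator_of_mem hi _).symm)
  have hle' : ∀ᶠ i in l, ∀ᵐ x ∂μ, ‖(B i).indicator (F i) x‖ ≤ |h x| := by
    filter_upwards [hle] with i hi
    filter_upwards [hi] with x hx
    rw [norm_indicator_eq_indicator_norm]
    exact Set.indicator_apply_le' (fun hxB => (hx hxB).trans (le_abs_self _)) fun _ => abs_nonneg _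
  refine ⟨integrable_of_tendsto_of_dominated hmeas hh.abs hle' hlim', ?_⟩
  simp only [← integral_indicator (hB.measurableSet _)]
  exact tendsto_integral_filter_of_dominated_convergence _ (.of_forall hmeas) hle' hh.abs hlim'

end DominatedConvergence

end ManyBody

theorem mainTheorem12_general {A : ℕ} (m : Fin A → ℝ) (_hm : ∀ a, m a ≠ 0) (M : ℝ)
    (V : ManyBody.Config A → ℝ) (hV : LocallyIntegrable V volume) (E : ℝ)
    (ξ φ g : ManyBody.Config A → ℂ)
    (hξ : ManyBody.IsEigenstate m V E ξ) (hξb : BddAbove (Set.range fun x => ‖ξ x‖))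
    (hφ : ManyBody.IsSchrodingerViolation m V E φ g) (hg : Integrable g volume) :
    ∃ L : ℂ,
      Tendsto (fun R : ℝ => ∑ a : Fin A, ((M / m a : ℝ) : ℂ) *
          ∫ y in {y : ManyBody.Others a | ∀ b, ‖y b‖ < R},
            ManyBody.surfaceTerm ξ φ a R y) atTop (𝓝 L) ∧
      ‖L‖ ≤ 2 * |M| * (⨆ x, ‖ξ x‖) * ∫ x, ‖g x‖ ∧
      ∀ (w : (a : Fin A) → ManyBody.Others a → ℂ) (h : (a : Fin A) → ManyBody.Others a → ℝ),
        (∀ a, ∀ᵐ y : ManyBody.Others a, Tendsto (fun R : ℝ =>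
          ManyBody.surfaceTerm ξ φ a R y) atTop (𝓝 (w a y))) →
        (∀ a, Integrable (h a) volume) →
        (∀ a, ∀ᶠ R : ℝ in atTop, ∀ᵐ y : ManyBody.Others a, (∀ b, ‖y b‖ < R) →
          ‖ManyBody.surfaceTerm ξ φ a R y‖ ≤ h a y) →
        (∀ a, Integrable (w a) volume) ∧
          ∑ a : Fin A, ((M / m a : ℝ) : ℂ) * ∫ y, w a y = L ∧
          ‖∑ a : Fin A, ((M / m a : ℝ) : ℂ) * ∫ y, w a y‖
            ≤ 2 * |M| * (⨆ x, ‖ξ x‖) * ∫ x, ‖g x‖ := by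
  have hL := hξ.tendsto_sum_integral_surfaceTerm hV hξb hφ hg M
  have hbound : ‖((2 * M : ℝ) : ℂ) * ∫ x, g x * conj (ξ x)‖
      ≤ 2 * |M| * (⨆ x, ‖ξ x‖) * ∫ x, ‖g x‖ := by
    rw [norm_mul, Complex.norm_real, norm_mul, Real.norm_two, Real.norm_eq_abs,
      mul_assoc (2 * |M|)]
    gcongr
    exact ManyBody.norm_integral_mul_conj_le hg hξb
  refine ⟨_, hL, hbound, fun w h hw hh hdom => ?_⟩
  have hlim := fun a => ManyBody.integrable_and_tendsto_setIntegral_of_dominated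
    (ManyBody.aecover_ballProd volume)
    (fun R => ((ManyBody.continuous_surfaceTerm hξ.1 hφ.1 a).comp
      (Continuous.prodMk_right R)).aestronglyMeasurable) (hh a) (hdom a) (hw a)
  have hsum : ∑ a : Fin A, ((M / m a : ℝ) : ℂ) * ∫ y, w a y
      = ((2 * M : ℝ) : ℂ) * ∫ x, g x * conj (ξ x) :=
    tendsto_nhds_unique (tendsto_finsetSum _ fun a _ => (hlim a).2.const_mul _) hL
  exact ⟨fun a => (hlim a).1, hsum, hsum ▸ hbound⟩

theorem mainTheorem12 {A : ℕ} (m : Fin A → ℝ) (hm : ∀ a, 0 < m a) (M : ℝ) (hM : 0 < M)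
    (V : ManyBody.Config A → ℝ) (hV : ManyBody.IsLocalPotential V) (E : ℝ)
    (ξ ψ ψ' g : ManyBody.Config A → ℂ)
    (hξ : ManyBody.IsEigenstate m V E ξ) (hξb : BddAbove (Set.range fun x => ‖ξ x‖))
    (hψ : ManyBody.IsEigenstate m V E ψ)
    (hψ' : ManyBody.IsSchrodingerViolation m V E ψ' g) (hg : Integrable g volume) :
    ∃ L : ℂ,
      Tendsto (fun R : ℝ => ∑ a : Fin A, ((M / m a : ℝ) : ℂ) *
          ∫ y in {y : ManyBody.Others a | ∀ b, ‖y b‖ < R},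
            ManyBody.surfaceTerm ξ (fun x => ψ' x - ψ x) a R y) atTop (𝓝 L) ∧
      ‖L‖ ≤ 2 * M * (⨆ x, ‖ξ x‖) * ∫ x, ‖g x‖ ∧
      ∀ (w : (a : Fin A) → ManyBody.Others a → ℂ) (h : (a : Fin A) → ManyBody.Others a → ℝ),
        (∀ a, ∀ᵐ y : ManyBody.Others a, Tendsto (fun R : ℝ =>
          ManyBody.surfaceTerm ξ (fun x => ψ' x - ψ x) a R y) atTop (𝓝 (w a y))) →
        (∀ a, Integrable (h a) volume) →
        (∀ a, ∀ᶠ R : ℝ in atTop, ∀ᵐ y : ManyBody.Others a, (∀ b, ‖y b‖ < R) →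
          ‖ManyBody.surfaceTerm ξ (fun x => ψ' x - ψ x) a R y‖ ≤ h a y) →
        (∀ a, Integrable (w a) volume) ∧
          ∑ a : Fin A, ((M / m a : ℝ) : ℂ) * ∫ y, w a y = L ∧
          ‖∑ a : Fin A, ((M / m a : ℝ) : ℂ) * ∫ y, w a y‖
            ≤ 2 * M * (⨆ x, ‖ξ x‖) * ∫ x, ‖g x‖ := by
  have hφ := hψ'.sub hV.locallyIntegrable hψ
  simpa only [sub_zero, abs_of_pos hM] using mainTheorem12_general m (fun a => (hm a).ne') M V
    hV.locallyIntegrable E ξ _ g hξ hξb (by simpa only [sub_zero] using hφ) hg
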